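/- For $A\subseteq\mathbb{R}^d$ let $A^\circ=\{x\in\mathbb{R}^d:\langle x,a\rangle\le 1\text{ for all }a\in A\}$ be its polar. A polytope is the convex hull of a finite set of points in $\mathbb{R}^d$; its dimension is the dimension of its affine span, and its vertices are the points of the unique minimal finite set whose convex hull it is (equivalently, its extreme points). A polytope $P\subset\mathbb{R}^d$ is called negatively self-polar if $P=-P^\circ$. **Theorem.** Let $d\ge 3$ and $n\ge d+1$ be integers. Then there exists a $d$-dimensional negatively self-polar polytope $P\subset\mathbb{R}^d$ with exactly $n$ vertices if and only if $n\neq d+2$. -/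

import Mathlib

open scoped Pointwise

/-- A polytope in `ℝ^d`: the convex hull of a finite set of points. -/
def IsPolytope {d : ℕ} (P : Set (EuclideanSpace ℝ (Fin d))) : Prop :=
  ∃ s : Set (EuclideanSpace ℝ (Fin d)), s.Finite ∧ P = convexHull ℝ s

/-- The dimension of a set is the dimension of its affine span (the empty set gets the value `0`). -/
noncomputable def affDim {d : ℕ} (P : Set (EuclideanSpace ℝ (Fin d))) : ℕ :=
  Module.finrank ℝ (affineSpan ℝ P).direction

/-- The vertices of a polytope are its extreme points; for a polytope they form
the unique minimal finite set whose convex hull is `P`. -/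
def vert {d : ℕ} (P : Set (EuclideanSpace ℝ (Fin d))) : Set (EuclideanSpace ℝ (Fin d)) :=
  P.extremePoints ℝ

/-- The (one-sided) polar `A° = {x | ⟨x, a⟩ ≤ 1 for all a ∈ A}`. -/
def polarSet {d : ℕ} (A : Set (EuclideanSpace ℝ (Fin d))) : Set (EuclideanSpace ℝ (Fin d)) :=
  {x | ∀ a ∈ A, inner ℝ x a ≤ 1}

/-- `A` is negatively self-polar: `A = -A°`. -/
def IsNegSelfPolar {d : ℕ} (A : Set (EuclideanSpace ℝ (Fin d))) : Prop :=
  A = -polarSet A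

/-! Obstruction (`IsNegSelfPolar.ncard_vert_ne`). The constraints active at a vertex `v` are the
vertices `u` with `⟪v, u⟫ = -1`, and extremality forces them to span, so there are at least `d`.
With `d + 2` vertices, each row of the matrix `⟪v, u⟫ + 1` then has its positive diagonal entry and
at most one other nonzero entry. An affine dependency of the vertices lies in the kernel, so some
2×2 principal minor vanishes. This minor is the Gram determinant of `(x, 1)` and `(y, 1)`, so
Cauchy–Schwarz gives `x = y`, a contradiction.

Existence rests on two operations. A pyramid takes `(d, n)` to `(d + 1, n + 1)`. Truncating a simple
vertex, while stacking a point beyond its dual facet, takes `(d, n)` to `(d, n + d)` for `d ≥ 2`.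
Both leave a simple vertex, so they can be iterated. From a point in dimension 0, pyramids give a
triangle, truncations give 5 and 7 vertices in the plane, and pyramids over these give 4, 6, 8 in
space. Adding multiples of 3 reaches every `n ≥ 4` except 5, and pyramids carry this to all higher
dimensions. -/

open scoped RealInnerProductSpace

/-! ### Active constraints and the exclusion of `d + 2` vertices -/

section Obstruction

variable {d : ℕ} {P : Set (EuclideanSpace ℝ (Fin d))}

theorem IsPolytope.finite_vert (hP : IsPolytope P) : (vert P).Finite := by
  obtain ⟨s, hs, rfl⟩ := hP
  exact hs.subset extremePoints_convexHull_subset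

theorem IsPolytope.convexHull_vert (hP : IsPolytope P) : convexHull ℝ (vert P) = P := by
  have hfin := hP.finite_vert
  obtain ⟨s, hs, rfl⟩ := hP
  have h := closure_convexHull_extremePoints (hs.isCompact_convexHull ℝ) (convex_convexHull ℝ s)
  exact (hfin.isClosed_convexHull ℝ).closure_eq.symm.trans h

theorem IsNegSelfPolar.mem_iff (hP : IsNegSelfPolar P) {x : EuclideanSpace ℝ (Fin d)} :
    x ∈ P ↔ ∀ y ∈ P, -1 ≤ ⟪x, y⟫ := by
  have h : x ∈ P ↔ x ∈ -polarSet P := by rw [← hP]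
  rw [h]
  simp only [polarSet, Set.mem_neg, Set.mem_ofPred_eq, inner_neg_left, neg_le]

theorem le_inner_of_mem_convexHull {E : Type*} [NormedAddCommGroup E] [InnerProductSpace ℝ E]
    {s : Set E} {f x : E} {c : ℝ} (h : ∀ y ∈ s, c ≤ ⟪f, y⟫) (hx : x ∈ convexHull ℝ s) :
    c ≤ ⟪f, x⟫ :=
  convexHull_min (t := {y | c ≤ ⟪f, y⟫}) h
    (convex_halfSpace_ge (innerSL ℝ f).toLinearMap.isLinear c) hx

theorem IsNegSelfPolar.mem_iff_vert (hP : IsNegSelfPolar P) (hpol : IsPolytope P)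
    {x : EuclideanSpace ℝ (Fin d)} : x ∈ P ↔ ∀ y ∈ vert P, -1 ≤ ⟪x, y⟫ := by
  refine ⟨fun hx y hy => hP.mem_iff.1 hx y hy.1, fun h => hP.mem_iff.2 fun y hy => ?_⟩
  rw [← hpol.convexHull_vert] at hy
  exact le_inner_of_mem_convexHull h hy

/-- The constraints which are active at a vertex have trivial orthogonal complement. -/
theorem IsNegSelfPolar.eq_zero_of_orthogonal (hP : IsNegSelfPolar P) (hpol : IsPolytope P)
    {v : EuclideanSpace ℝ (Fin d)} (hv : v ∈ vert P) {y : EuclideanSpace ℝ (Fin d)}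
    (hy : ∀ u ∈ vert P, ⟪v, u⟫ = -1 → ⟪y, u⟫ = 0) : y = 0 := by
  have key : ∀ z : EuclideanSpace ℝ (Fin d), (∀ u ∈ vert P, ⟪v, u⟫ = -1 → ⟪z, u⟫ = 0) →
      ∀ᶠ ε : ℝ in nhdsWithin 0 (Set.Ioi 0), v + ε • z ∈ P := by
    intro z hz
    have h : ∀ᶠ ε : ℝ in nhdsWithin 0 (Set.Ioi 0), ∀ u ∈ vert P, -1 ≤ ⟪v + ε • z, u⟫ := by
      rw [Filter.eventually_all_finite hpol.finite_vert]
      intro u hu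
      by_cases h : ⟪v, u⟫ = -1
      · exact Filter.Eventually.of_forall fun ε => by
          rw [inner_add_left, inner_smul_left, hz u hu h, h]; simp
      · have h1 : -1 < ⟪v, u⟫ := lt_of_le_of_ne (hP.mem_iff.1 hv.1 u hu.1) (Ne.symm h)
        have hc : ContinuousAt (fun ε : ℝ => ⟪v + ε • z, u⟫) 0 := by fun_prop
        have h2 : ∀ᶠ ε : ℝ in nhds 0, -1 < ⟪v + ε • z, u⟫ :=
          hc.eventually (lt_mem_nhds (by simpa using h1))
        exact (h2.filter_mono nhdsWithin_le_nhds).mono fun _ h => h.le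
    exact h.mono fun ε h => (hP.mem_iff_vert hpol).2 h
  -- The vertex `v` is the midpoint of `v + ε • y` and `v - ε • y`, both in `P` for small `ε`.
  obtain ⟨ε, ⟨h1, h2⟩, hε⟩ := (((key y hy).and (key (-y) fun u hu h => by
    rw [inner_neg_left, hy u hu h, neg_zero])).and self_mem_nhdsWithin).exists
  have hε' : (0 : ℝ) < ε := hε
  have h3 := (mem_extremePoints.1 hv).2 _ h1 _ h2 ⟨1 / 2, 1 / 2, by norm_num, by norm_num,
    by norm_num, by module⟩
  have h4 : ε • y = 0 := by simpa using h3.1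
  exact (smul_eq_zero.1 h4).resolve_left hε'.ne'

theorem IsNegSelfPolar.card_active (hP : IsNegSelfPolar P) (hpol : IsPolytope P)
    {v : EuclideanSpace ℝ (Fin d)} (hv : v ∈ vert P) :
    d ≤ {u ∈ vert P | ⟪v, u⟫ = -1}.ncard := by
  set A := {u ∈ vert P | ⟪v, u⟫ = -1} with hA
  have hfin : A.Finite := hpol.finite_vert.subset fun u hu => hu.1
  have hspan : Submodule.span ℝ A = ⊤ := by
    rw [← Submodule.orthogonal_eq_bot_iff, Submodule.eq_bot_iff]
    intro y hy
    refine hP.eq_zero_of_orthogonal hpol hv fun u hu h => ?_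
    have hu' : u ∈ Submodule.span ℝ A := Submodule.subset_span ⟨hu, h⟩
    exact Submodule.inner_left_of_mem_orthogonal hu' hy
  have := hfin.fintype
  have h := finrank_span_le_card (R := ℝ) A
  rwa [hspan, finrank_top, finrank_euclideanSpace_fin, ← Set.ncard_eq_toFinset_card'] at h

theorem IsNegSelfPolar.ncard_vert_ne (hP : IsNegSelfPolar P) (hpol : IsPolytope P) :
    (vert P).ncard ≠ d + 2 := by
  classical
  intro hn
  have hfin := hpol.finite_vert
  set V := hfin.toFinset with hV
  have hmem : ∀ {x}, x ∈ V ↔ x ∈ vert P := by simp [hV]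
  have hVcard : V.card = d + 2 := by rw [← hn, Set.ncard_eq_toFinset_card _ hfin]
  -- at most one other vertex does not lie on the facet dual to `v`
  have huniq : ∀ v ∈ V, ∀ u ∈ V, ∀ u' ∈ V, u ≠ v → u' ≠ v → ⟪v, u⟫ ≠ -1 → ⟪v, u'⟫ ≠ -1 →
      u = u' := by
    intro v hv u hu u' hu' huv hu'v h h'
    by_contra hne
    have h1 := hP.card_active hpol (hmem.1 hv)
    have h2 : {u ∈ vert P | ⟪v, u⟫ = -1} ⊆ ((V \ {v, u, u'} : Finset _) : Set _) := by
      rintro x ⟨hx, hx'⟩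
      simp only [Finset.coe_sdiff, Set.mem_sdiff, Finset.mem_coe, hmem]
      refine ⟨hx, ?_⟩
      simp only [Finset.mem_insert, Finset.mem_singleton]
      rintro (rfl | rfl | rfl)
      · have := real_inner_self_nonneg (x := x); linarith
      · exact h hx'
      · exact h' hx'
    have h3 := h1.trans (Set.ncard_le_ncard h2 (Finset.finite_toSet _))
    have hsub : {v, u, u'} ⊆ V := by simp [Finset.insert_subset_iff, hv, hu, hu']
    have h4 := Finset.card_sdiff_add_card_eq_card hsub
    rw [Finset.card_eq_three.2 ⟨v, u, u', huv.symm, hu'v.symm, hne, rfl⟩, hVcard] at h4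
    rw [Set.ncard_coe_finset] at h3
    omega
  -- Any `d + 2` points of `ℝ^d` are affinely dependent.
  obtain ⟨c, hc, hc0, x, hx, hcx⟩ :=
    Module.exists_nontrivial_relation_sum_zero_of_finrank_succ_lt_card (R := ℝ) (t := V)
      (by rw [finrank_euclideanSpace_fin, hVcard]; omega)
  have hrow : ∀ v, ∑ u ∈ V, c u * (⟪v, u⟫ + 1) = 0 := by
    intro v
    have h : ⟪v, ∑ u ∈ V, c u • u⟫ = 0 := by rw [hc, inner_zero_right]
    simp only [inner_sum, inner_smul_right] at h
    simp only [mul_add, mul_one, Finset.sum_add_distrib, h, hc0, add_zero]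
  have hpos : ∀ v : EuclideanSpace ℝ (Fin d), 0 < ⟪v, v⟫ + 1 := fun v => by
    have := real_inner_self_nonneg (x := v); linarith
  -- a partner of `x` in the dependency
  have hex : ∃ y ∈ V, y ≠ x ∧ ⟪x, y⟫ ≠ -1 := by
    by_contra! hno
    have h := hrow x
    rw [Finset.sum_eq_single_of_mem x hx fun u hu hux => by rw [hno u hu hux]; ring] at h
    exact (mul_ne_zero hcx (hpos x).ne') h
  obtain ⟨y, hy, hyx, hxy⟩ := hex
  have hpair : ∀ v ∈ V, ∀ u ∈ V, u ≠ v → ⟪v, u⟫ ≠ -1 →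
      c v * (⟪v, v⟫ + 1) + c u * (⟪v, u⟫ + 1) = 0 := by
    intro v hv u hu huv h
    rw [← Finset.sum_pair huv.symm (f := fun u => c u * (⟪v, u⟫ + 1)), ← hrow v]
    refine Finset.sum_subset (by simp [Finset.insert_subset_iff, hu, hv]) fun z hz hz' => ?_
    simp only [Finset.mem_insert, Finset.mem_singleton, not_or] at hz'
    by_contra hne
    refine hz'.2 (huniq v hv z hz u hu hz'.1 huv (fun h0 => hne ?_) h)
    rw [h0]; ring
  have e1 := hpair x hx y hy hyx hxy
  have e2 := hpair y hy x hx hyx.symm (by rwa [real_inner_comm])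
  rw [real_inner_comm x y] at e2
  -- The nonzero vector `(c x, c y)` is killed by a symmetric 2×2 matrix, so its determinant is
  -- zero. Expanded, this reads `‖x - y‖² = ⟪x, y⟫² - ‖x‖²‖y‖² ≤ 0`.
  have hdet : (⟪x, x⟫ + 1) * (⟪y, y⟫ + 1) = (⟪x, y⟫ + 1) ^ 2 := by
    apply mul_left_cancel₀ hcx
    linear_combination (⟪y, y⟫ + 1) * e1 - (⟪x, y⟫ + 1) * e2
  have hcs := real_inner_mul_inner_self_le x y
  have hsub : ⟪x - y, x - y⟫ = ⟪x, x⟫ - 2 * ⟪x, y⟫ + ⟪y, y⟫ := real_inner_sub_sub_self x y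
  have hnn := real_inner_self_nonneg (x := x - y)
  refine hyx.symm (sub_eq_zero.1 (inner_self_eq_zero (𝕜 := ℝ).1 ?_))
  nlinarith

end Obstruction

theorem lt_average {ι : Type*} [Fintype ι] {c : ι → ℝ} {r : ℝ}
    (h : ∀ i, r ≤ c i) (h' : ∃ i, r < c i) : r < (Fintype.card ι : ℝ)⁻¹ * ∑ i, c i := by
  obtain ⟨i, hi⟩ := h'
  have hpos : (0 : ℝ) < Fintype.card ι := by
    exact_mod_cast Fintype.card_pos_iff.2 ⟨i⟩
  have hs : ∑ _i : ι, r < ∑ i, c i :=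
    Finset.sum_lt_sum (fun j _ => h j) ⟨i, Finset.mem_univ i, hi⟩
  rw [Finset.sum_const, Finset.card_univ, nsmul_eq_mul] at hs
  rw [inv_mul_eq_div, lt_div_iff₀ hpos]
  linarith

/-! ### Self-polar families and simple vertices -/

section Families

variable {E : Type*} [NormedAddCommGroup E] [InnerProductSpace ℝ E]

/-- The points `v i` are the vertices of a negatively self-polar polytope. -/
structure IsSelfPolarFamily {ι : Type*} (v : ι → E) : Prop where
  neg_one_le_inner : ∀ i j, -1 ≤ ⟪v i, v j⟫
  mem_convexHull : ∀ x, (∀ i, -1 ≤ ⟪x, v i⟫) → x ∈ convexHull ℝ (Set.range v)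
  exposed : ∀ i, ∃ f : E, ∀ j, j ≠ i → ⟪f, v i⟫ < ⟪f, v j⟫

/-- The vertex `v i₀` lies on exactly the facets dual to the points `v (a k)`,
and these are linearly independent when their number is the dimension. -/
structure IsSimpleVertex {ι κ : Type*} (v : ι → E) (i₀ : ι) (a : κ → ι) : Prop where
  inner_eq_iff : ∀ j, ⟪v i₀, v j⟫ = -1 ↔ j ∈ Set.range a
  eq_zero : ∀ x : E, (∀ k, ⟪x, v (a k)⟫ = 0) → x = 0

theorem IsSelfPolarFamily.injective {ι : Type*} {v : ι → E} (h : IsSelfPolarFamily v) :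
    Function.Injective v := by
  intro i j hij
  by_contra hne
  obtain ⟨f, hf⟩ := h.exposed i
  exact (hf j (Ne.symm hne)).ne (by rw [hij])

theorem mem_convexHull_range_split {ι : Type*} {v : ι → E} (i : ι) {x : E}
    (hx : x ∈ convexHull ℝ (Set.range v)) :
    x = v i ∨ ∃ y ∈ convexHull ℝ (v '' {i}ᶜ), x ∈ segment ℝ (v i) y := by
  have hr : Set.range v = insert (v i) (v '' {i}ᶜ) := by
    ext y
    constructor
    · rintro ⟨j, rfl⟩
      by_cases hj : j = i
      · exact Or.inl (by rw [hj])
      · exact Or.inr ⟨j, hj, rfl⟩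
    · rintro (rfl | ⟨j, _, rfl⟩)
      exacts [⟨i, rfl⟩, ⟨j, rfl⟩]
  rcases Set.eq_empty_or_nonempty (v '' {i}ᶜ) with h | h
  · rw [hr, h] at hx
    left
    simpa using hx
  · rw [hr, convexHull_insert h, mem_convexJoin] at hx
    obtain ⟨_, rfl, y, hy, hxy⟩ := hx
    exact Or.inr ⟨y, hy, hxy⟩

theorem eq_of_inner_le_of_exposed {ι : Type*} {v : ι → E} {f : E} {i : ι}
    (hf : ∀ j, j ≠ i → ⟪f, v i⟫ < ⟪f, v j⟫) {x : E} (hx : x ∈ convexHull ℝ (Set.range v))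
    (hle : ⟪f, x⟫ ≤ ⟪f, v i⟫) : x = v i := by
  rcases mem_convexHull_range_split i hx with h | ⟨y, hy, s, t, hs, ht, hst, rfl⟩
  · exact h
  · have hlt : ⟪f, v i⟫ < ⟪f, y⟫ := by
      refine convexHull_min (t := {y | ⟪f, v i⟫ < ⟪f, y⟫}) ?_
        (convex_halfSpace_gt (innerSL ℝ f).toLinearMap.isLinear _) hy
      rintro _ ⟨j, hj, rfl⟩
      exact hf j hj
    rw [inner_add_right, inner_smul_right, inner_smul_right] at hle
    obtain rfl : s = 1 - t := by linarith
    obtain rfl : t = 0 := le_antisymm (by nlinarith) ht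
    simp

theorem IsSelfPolarFamily.extremePoints_eq {ι : Type*} {v : ι → E}
    (h : IsSelfPolarFamily v) : (convexHull ℝ (Set.range v)).extremePoints ℝ = Set.range v := by
  refine Set.Subset.antisymm extremePoints_convexHull_subset ?_
  rintro _ ⟨i, rfl⟩
  obtain ⟨f, hf⟩ := h.exposed i
  have hle : ∀ y ∈ convexHull ℝ (Set.range v), ⟪f, v i⟫ ≤ ⟪f, y⟫ := fun y hy => by
    refine le_inner_of_mem_convexHull ?_ hy
    rintro _ ⟨j, rfl⟩
    by_cases hj : j = i
    · rw [hj]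
    · exact (hf j hj).le
  refine mem_extremePoints.2 ⟨subset_convexHull ℝ _ ⟨i, rfl⟩, fun x hx y hy hxy => ?_⟩
  obtain ⟨s, t, hs, ht, hst, heq⟩ := hxy
  have h1 := hle x hx
  have h2 := hle y hy
  have h3 : s * ⟪f, x⟫ + t * ⟪f, y⟫ = ⟪f, v i⟫ := by
    rw [← heq, inner_add_right, inner_smul_right, inner_smul_right]
  obtain rfl : t = 1 - s := by linarith
  exact ⟨eq_of_inner_le_of_exposed hf hx (by nlinarith),
    eq_of_inner_le_of_exposed hf hy (by nlinarith)⟩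

theorem IsSelfPolarFamily.convexHull_mem_nhds {ι : Type*} [Finite ι] {v : ι → E}
    (h : IsSelfPolarFamily v) : convexHull ℝ (Set.range v) ∈ nhds (0 : E) := by
  have : ∀ᶠ x : E in nhds 0, ∀ i, -1 ≤ ⟪x, v i⟫ := by
    rw [Filter.eventually_all]
    intro i
    have hc : ContinuousAt (fun x : E => ⟪x, v i⟫) 0 := by fun_prop
    exact (hc.eventually (lt_mem_nhds (a := -1) (by simp))).mono fun _ h => h.le
  exact this.mono fun x hx => h.mem_convexHull x hx

theorem IsSelfPolarFamily.affineSpan_eq_top {ι : Type*} [Finite ι] {v : ι → E}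
    (h : IsSelfPolarFamily v) : affineSpan ℝ (convexHull ℝ (Set.range v)) = ⊤ := by
  rw [affineSpan_convexHull]
  exact affineSpan_eq_top_of_nonempty_interior
    ⟨0, mem_interior_iff_mem_nhds.2 h.convexHull_mem_nhds⟩

/-- Since 0 is interior to the hull, a small multiple of `-x` lies in it and violates the bound
unless `x = 0`. In the pyramid this shows that the apex is the only point at height at least 1. -/
theorem IsSelfPolarFamily.eq_zero_of_le_inner {ι : Type*} [Finite ι] {v : ι → E}
    (h : IsSelfPolarFamily v) {x : E} {c : ℝ} (hc : 0 ≤ c) (hx : ∀ i, c ≤ ⟪x, v i⟫) :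
    c = 0 ∧ x = 0 := by
  have hcont : ContinuousAt (fun δ : ℝ => δ • -x) 0 := by fun_prop
  have hev : ∀ᶠ δ : ℝ in nhdsWithin 0 (Set.Ioi 0), δ • -x ∈ convexHull ℝ (Set.range v) :=
    (hcont.eventually (by simpa using h.convexHull_mem_nhds)).filter_mono nhdsWithin_le_nhds
  obtain ⟨δ, hδ, hδ0⟩ := (hev.and self_mem_nhdsWithin).exists
  have hδ0 : 0 < δ := hδ0
  have hle : c ≤ ⟪x, δ • -x⟫ := by
    refine le_inner_of_mem_convexHull ?_ hδ
    rintro _ ⟨i, rfl⟩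
    exact hx i
  rw [inner_smul_right, inner_neg_right] at hle
  have hnn := real_inner_self_nonneg (x := x)
  have hmul := mul_nonneg hδ0.le hnn
  have hc0 : c = 0 := by linarith
  refine ⟨hc0, inner_self_eq_zero (𝕜 := ℝ).1 ?_⟩
  exact (mul_eq_zero.1 (by linarith : δ * ⟪x, x⟫ = 0)).resolve_left hδ0.ne'

/-- The dual basis `e k` gives the edge directions at the simple vertex: moving along `e k` leaves
the facet dual to `v (a k)` and stays on the others. -/
theorem IsSimpleVertex.exists_dual [FiniteDimensional ℝ E] {ι κ : Type*} [Fintype κ] [DecidableEq κ]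
    {v : ι → E} {i₀ : ι} {a : κ → ι} (h : IsSimpleVertex v i₀ a)
    (hcard : Fintype.card κ = Module.finrank ℝ E) :
    ∃ e : κ → E, (∀ k l, ⟪e k, v (a l)⟫ = if k = l then 1 else 0) ∧
      (∀ x, ∑ k, ⟪e k, x⟫ • v (a k) = x) ∧ ∀ x, ∑ k, ⟪x, v (a k)⟫ • e k = x := by
  have hspan : Submodule.span ℝ (Set.range (v ∘ a)) = ⊤ := by
    rw [← Submodule.orthogonal_eq_bot_iff, Submodule.eq_bot_iff]
    refine fun y hy => h.eq_zero y fun k => ?_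
    have hk : v (a k) ∈ Submodule.span ℝ (Set.range (v ∘ a)) := Submodule.subset_span ⟨k, rfl⟩
    exact Submodule.inner_left_of_mem_orthogonal hk hy
  let b := basisOfTopLeSpanOfCardEqFinrank (v ∘ a) hspan.ge hcard
  have hb : ∀ k, b k = v (a k) := fun k => by simp [b]
  let e : κ → E := fun k => (InnerProductSpace.toDual ℝ E).symm (b.coord k).toContinuousLinearMap
  have he : ∀ k x, ⟪e k, x⟫ = b.repr x k := fun k x => by simp [e]
  have hδ : ∀ k l, ⟪e k, v (a l)⟫ = if k = l then 1 else 0 := fun k l => by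
    rw [he, ← hb, b.repr_self, Finsupp.single_apply]
    simp [eq_comm]
  refine ⟨e, hδ, fun x => ?_, fun x => ?_⟩
  · simp only [he, ← hb]
    exact b.sum_repr x
  · rw [← sub_eq_zero]
    refine h.eq_zero _ fun l => ?_
    simp [inner_sub_left, sum_inner, inner_smul_left, hδ]

end Families

/-! ### Truncating a simple vertex and stacking its dual facet -/

section Truncation

variable {E : Type*} [NormedAddCommGroup E] [InnerProductSpace ℝ E]
  {ι κ : Type*} [Fintype κ] [DecidableEq ι] [DecidableEq κ]

/-- Replacing a simple vertex `v i₀` by a point `w` beyond the facet dual to it, and truncating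
that vertex by the hyperplane dual to `w`. The points `p k` are the new vertices on the edges
through `v i₀`. -/
theorem IsSelfPolarFamily.truncate [Nontrivial κ] {v : ι → E} (h : IsSelfPolarFamily v)
    {i₀ : ι} {a : κ → ι} (hs : IsSimpleVertex v i₀ a) {e : κ → E}
    (hδ : ∀ k l, ⟪e k, v (a l)⟫ = if k = l then 1 else 0)
    (hbasis : ∀ x, ∑ k, ⟪e k, x⟫ • v (a k) = x) (hdual : ∀ x, ∑ k, ⟪x, v (a k)⟫ • e k = x)
    {ε t q : ℝ} (hε : 0 < ε) (ht : 0 < t) (hq : 0 < q) (hqm : q * Fintype.card κ = 1 + ε)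
    (htq : t * q = ε) {w : E} {p : κ → E} (hw : w = q • ∑ l, v (a l))
    (hp : ∀ k, p k = v i₀ + t • e k) (hwv : ∀ i, i ≠ i₀ → -1 < ⟪w, v i⟫)
    (hpv : ∀ k i, i ∉ Set.range a → -1 < ⟪p k, v i⟫) (hpp : ∀ k l, -1 < ⟪p k, p l⟫)
    (hexp : ∀ i, i ≠ i₀ → ∃ f : E, (∀ j, j ≠ i → ⟪f, v i⟫ < ⟪f, v j⟫) ∧ ⟪f, v i⟫ < ⟪f, w⟫ ∧
      ∀ k, ⟪f, v i⟫ < ⟪f, p k⟫) :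
    IsSelfPolarFamily (Sum.elim (Function.update v i₀ w) p) ∧
      ∀ k, IsSimpleVertex (Sum.elim (Function.update v i₀ w) p) (Sum.inr k)
        (fun l => if l = k then Sum.inl i₀ else Sum.inl (a l)) := by
  have hnn : ∀ x : E, -1 < ⟪x, x⟫ := fun x => by
    have := real_inner_self_nonneg (x := x); linarith
  have hi₀ : i₀ ∉ Set.range a := fun hi => (hnn (v i₀)).ne' ((hs.inner_eq_iff i₀).2 hi)
  have ha : ∀ l, a l ≠ i₀ := fun l hl => hi₀ ⟨l, hl⟩
  have hva : ∀ l, ⟪v i₀, v (a l)⟫ = -1 := fun l => (hs.inner_eq_iff _).2 ⟨l, rfl⟩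
  have hpb : ∀ k l, ⟪p k, v (a l)⟫ = -1 + if k = l then t else 0 := fun k l => by
    rw [hp, inner_add_left, inner_smul_left, hva, hδ]; simp
  have hwx : ∀ x, ⟪w, x⟫ = q * ∑ l, ⟪x, v (a l)⟫ := fun x => by
    rw [real_inner_comm, hw, inner_smul_right, inner_sum]
  -- The relations on `q` and `t` are chosen for this: `q * (t - card κ) = ε - (1 + ε) = -1`.
  have hwp : ∀ k, ⟪w, p k⟫ = -1 := fun k => by
    rw [hwx]
    simp only [hpb, Finset.sum_add_distrib, Finset.sum_ite_eq, Finset.mem_univ, if_true,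
      Finset.sum_const, Finset.card_univ, nsmul_eq_mul]
    linear_combination htq - hqm
  have hv₀w : ⟪v i₀, w⟫ = -(1 + ε) := by
    rw [real_inner_comm, hwx]
    simp only [hva, Finset.sum_const, Finset.card_univ, nsmul_eq_mul]
    linear_combination -hqm
  set u := Sum.elim (Function.update v i₀ w) p with hu
  have hu₀ : u (Sum.inl i₀) = w := Function.update_self ..
  have hul : ∀ i, i ≠ i₀ → u (Sum.inl i) = v i := fun i hi => Function.update_of_ne hi ..
  have hur : ∀ k, u (Sum.inr k) = p k := fun k => rfl
  -- pairwise inequalities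
  have hpv' : ∀ k i, i ≠ i₀ → -1 ≤ ⟪p k, v i⟫ := fun k i _ => by
    by_cases hia : i ∈ Set.range a
    · obtain ⟨l, rfl⟩ := hia
      rw [hpb]
      split_ifs <;> linarith
    · exact (hpv k i hia).le
  have hlb : ∀ i j, -1 ≤ ⟪u i, u j⟫ := by
    rintro (i | k) (j | l)
    · by_cases hi : i = i₀ <;> by_cases hj : j = i₀
      · rw [hi, hj]; exact (hnn _).le
      · rw [hi, hu₀, hul j hj]; exact (hwv j hj).le
      · rw [hj, hu₀, hul i hi, real_inner_comm]; exact (hwv i hi).le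
      · rw [hul i hi, hul j hj]; exact h.neg_one_le_inner i j
    · by_cases hi : i = i₀
      · rw [hi, hu₀, hur, hwp]
      · rw [hul i hi, hur, real_inner_comm]; exact hpv' l i hi
    · by_cases hj : j = i₀
      · rw [hj, hu₀, hur, real_inner_comm, hwp]
      · rw [hul j hj, hur]; exact hpv' k j hj
    · exact (hpp k l).le
  have hw_lt : ∀ i, -1 < ⟪w, u (Sum.inl i)⟫ := fun i => by
    by_cases hi : i = i₀
    · rw [hi, hu₀]; exact hnn w
    · rw [hul i hi]; exact hwv i hi
  have hconv : Convex ℝ (convexHull ℝ (Set.range u)) := convex_convexHull ℝ _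
  have hmem : ∀ i, u i ∈ convexHull ℝ (Set.range u) := fun i => subset_convexHull ℝ _ ⟨i, rfl⟩
  refine ⟨⟨hlb, fun x hx => ?_, fun i => ?_⟩, fun k => ⟨fun j => ?_, fun x hx => ?_⟩⟩
  · have hxw : -1 ≤ q * ∑ l, ⟪x, v (a l)⟫ := by
      rw [← hwx, real_inner_comm, ← hu₀]; exact hx _
    rcases le_or_gt (-1) ⟪x, v i₀⟫ with hx₀ | hx₀
    · -- the part of the polytope which is kept
      have hxv : x ∈ convexHull ℝ (Set.range v) := h.mem_convexHull x fun i => by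
        by_cases hi : i = i₀
        · rwa [hi]
        · rw [← hul i hi]; exact hx _
      rcases mem_convexHull_range_split i₀ hxv with rfl | ⟨y, hy, r, μ, hr, hμ, hrμ, rfl⟩
      · rw [← hwx, real_inner_comm, hv₀w] at hxw
        linarith
      obtain rfl : r = 1 - μ := by linarith
      have hyu : y ∈ convexHull ℝ (Set.range u) := by
        refine convexHull_mono ?_ hy
        rintro _ ⟨i, hi, rfl⟩
        exact ⟨Sum.inl i, hul i hi⟩
      have hyc : ∀ k, 0 ≤ ⟪y, v (a k)⟫ + 1 := fun k => by
        rw [real_inner_comm]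
        have := le_inner_of_mem_convexHull (f := v (a k)) (c := -1) ?_ hy
        · linarith
        · rintro _ ⟨i, hi, rfl⟩
          exact h.neg_one_le_inner _ _
      have hyexp : ∑ k, (⟪y, v (a k)⟫ + 1) • e k = y - v i₀ := by
        rw [← hdual (y - v i₀)]
        exact Finset.sum_congr rfl fun k _ => by rw [inner_sub_left, hva, sub_neg_eq_add]
      set Y := ∑ k, (⟪y, v (a k)⟫ + 1) with hY
      have hYμ : t ≤ μ * Y := by
        have h1 : ∑ l, ⟪(1 - μ) • v i₀ + μ • y, v (a l)⟫ = μ * Y - Fintype.card κ := by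
          simp only [inner_add_left, inner_smul_left, hva, hY, Finset.sum_add_distrib,
            Finset.mul_sum, mul_add, Finset.sum_const, Finset.card_univ, nsmul_eq_mul]
          simp
          ring
        rw [h1] at hxw
        have h2 : q * t ≤ q * (μ * Y) := by linarith
        exact le_of_mul_le_mul_left h2 hq
      have hY0 : 0 < Y := by
        by_contra hY0
        nlinarith [mul_nonneg hμ (neg_nonneg.2 (not_lt.1 hY0))]
      -- The segment from `v i₀` to `y` meets the hyperplane dual to `w` at parameter `θ`, in a
      -- convex combination of the `p k`; `x` lies between that point and `y`.
      set θ := t / Y with hθ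
      have hθY : θ * Y = t := div_mul_cancel₀ _ hY0.ne'
      have hθ0 : 0 < θ := div_pos ht hY0
      have hθμ : θ ≤ μ := by rw [hθ, div_le_iff₀ hY0]; exact hYμ
      have hz : v i₀ + θ • (y - v i₀) ∈ convexHull ℝ (Set.range u) := by
        have hc : ∑ k, (⟪y, v (a k)⟫ + 1) / Y = 1 := by rw [← Finset.sum_div, div_self hY0.ne']
        have h1 : ∑ k, ((⟪y, v (a k)⟫ + 1) / Y) • p k ∈ convexHull ℝ (Set.range u) :=
          hconv.sum_mem (fun k _ => div_nonneg (hyc k) hY0.le)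
            hc fun k _ => hmem (Sum.inr k)
        convert h1 using 1
        simp only [hp, smul_add]
        rw [Finset.sum_add_distrib, ← Finset.sum_smul, hc, one_smul, ← hyexp, Finset.smul_sum]
        congr 1
        refine Finset.sum_congr rfl fun k _ => ?_
        rw [smul_smul, smul_smul, hθ]
        congr 1
        ring
      rcases eq_or_lt_of_le (show μ ≤ 1 by linarith) with rfl | hμ1
      · simpa using hyu
      have hθ1 : 0 < 1 - θ := by linarith
      have h2 := hconv hz hyu (a := (1 - μ) / (1 - θ)) (b := (μ - θ) / (1 - θ))
        (div_nonneg hr hθ1.le) (div_nonneg (by linarith) hθ1.le) (by field_simp; ring)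
      convert h2 using 1
      match_scalars
      · field_simp; ring
      · field_simp; ring
    · -- the new part, beyond the facet dual to `v i₀`
      have hxe : ∑ k, ⟪e k, x⟫ • v (a k) = x := hbasis x
      set σ := ∑ k, ⟪e k, x⟫ with hσ
      have hxσ : ⟪x, v i₀⟫ = -σ := by
        rw [real_inner_comm, ← hxe, inner_sum]
        simp only [inner_smul_right, hva]
        simp [hσ]
      have hxk : ∀ k, σ - 1 ≤ t * ⟪e k, x⟫ := fun k => by
        have h1 := hx (Sum.inr k)
        rw [hur, hp, inner_add_right, inner_smul_right, hxσ, real_inner_comm] at h1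
        linarith
      -- This weight on `w` makes the coefficients of `w` and the `v (a k)` sum to 1; the
      -- constraints from the `p k` make them nonnegative.
      set θ := (σ - 1) / ε with hθ
      have hθε : θ * ε = σ - 1 := div_mul_cancel₀ _ hε.ne'
      have hθ0 : 0 ≤ θ := div_nonneg (by linarith) hε.le
      have hxk' : ∀ k, 0 ≤ ⟪e k, x⟫ - θ * q := fun k => by
        have h1 : t * (θ * q) ≤ t * ⟪e k, x⟫ := by
          refine le_trans (le_of_eq ?_) (hxk k)
          rw [← hθε, ← htq]; ring
        exact sub_nonneg.2 (le_of_mul_le_mul_left h1 ht)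
      have h1 : ∑ o : Option κ, (Option.elim o θ fun k => ⟪e k, x⟫ - θ * q) •
          (Option.elim o w fun k => v (a k)) ∈ convexHull ℝ (Set.range u) := by
        refine hconv.sum_mem ?_ ?_ ?_
        · rintro (_ | k) _
          exacts [hθ0, hxk' k]
        · rw [Fintype.sum_option]
          simp only [Option.elim, Finset.sum_sub_distrib, Finset.sum_const, Finset.card_univ,
            nsmul_eq_mul, ← hσ]
          linear_combination (-θ) * hqm - hθε
        · rintro (_ | k) _
          · simpa [hu₀] using hmem (Sum.inl i₀)
          · simpa [hul _ (ha k)] using hmem (Sum.inl (a k))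
      rw [Fintype.sum_option] at h1
      convert h1 using 1
      simp only [Option.elim, sub_smul, Finset.sum_sub_distrib, hxe, hw, ← Finset.smul_sum]
      module
  · rcases i with i | k
    · by_cases hi : i = i₀
      · subst hi
        refine ⟨v i, ?_⟩
        rw [hu₀, hv₀w]
        rintro (j | k) hj
        · have hj' : j ≠ i := fun hji => hj (by rw [hji])
          rw [hul j hj']
          have := h.neg_one_le_inner i j
          linarith
        · rw [hur, real_inner_comm]
          have := hpv k i hi₀
          linarith
      · obtain ⟨f, hf, hfw, hfp⟩ := hexp i hi
        refine ⟨f, ?_⟩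
        rw [hul i hi]
        rintro (j | k) hj
        · by_cases hj' : j = i₀
          · rwa [hj', hu₀]
          · rw [hul j hj']
            exact hf j fun hji => hj (by rw [hji])
        · exact hfp k
    -- Sum of the constraints active at `p k`.
    · refine ⟨w + ∑ l ∈ Finset.univ.erase k, v (a l), ?_⟩
      have hb : ∀ l j, -1 ≤ ⟪v (a l), u j⟫ := fun l j => by
        rw [← hul _ (ha l)]; exact hlb _ _
      have hk : ∀ l ∈ Finset.univ.erase k, ⟪v (a l), p k⟫ = -1 := fun l hl => by
        rw [real_inner_comm, hpb, if_neg (Finset.ne_of_mem_erase hl).symm, add_zero]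
      rintro (j | l) hj
      · rw [hur, inner_add_left, inner_add_left, hwp, sum_inner, sum_inner]
        refine add_lt_add_of_lt_of_le (hw_lt j) (Finset.sum_le_sum fun l hl => ?_)
        rw [hk l hl]; exact hb _ _
      · have hlk : l ≠ k := fun h => hj (by rw [h])
        rw [hur, hur, inner_add_left, inner_add_left, hwp, hwp, sum_inner, sum_inner]
        refine add_lt_add_right (Finset.sum_lt_sum (fun m hm => ?_)
          ⟨l, Finset.mem_erase.2 ⟨hlk, Finset.mem_univ l⟩, ?_⟩) _
        · rw [hk m hm]; exact hb m (Sum.inr l)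
        · rw [hk l (Finset.mem_erase.2 ⟨hlk, Finset.mem_univ l⟩), real_inner_comm, hpb, if_pos rfl]
          linarith
  · rw [hur]
    rcases j with j | l
    · by_cases hj : j = i₀
      · rw [hj, hu₀, real_inner_comm, hwp]
        exact ⟨fun _ => ⟨k, by simp⟩, fun _ => rfl⟩
      · rw [hul j hj]
        constructor
        · intro hkj
          have hja : j ∈ Set.range a := by
            by_contra hja
            exact (hpv k j hja).ne' hkj
          obtain ⟨l, rfl⟩ := hja
          rw [hpb] at hkj
          refine ⟨l, ?_⟩
          have hlk : l ≠ k := by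
            rintro rfl
            rw [if_pos rfl] at hkj
            linarith
          simp [hlk]
        · rintro ⟨l, hl⟩
          by_cases hlk : l = k
          · simp only [hlk, if_true, Sum.inl.injEq] at hl
            exact absurd hl.symm hj
          · simp only [hlk, if_false, Sum.inl.injEq] at hl
            rw [← hl, hpb, if_neg (Ne.symm hlk), add_zero]
    · refine ⟨fun hkl => absurd hkl (hpp k l).ne', ?_⟩
      rintro ⟨m, hm⟩
      by_cases hmk : m = k <;> simp [hmk] at hm
  · have hxl : ∀ l, l ≠ k → ⟪x, v (a l)⟫ = 0 := fun l hl => by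
      simpa [hl, hul _ (ha l)] using hx l
    have hxw : ⟪x, w⟫ = 0 := by simpa [hu₀] using hx k
    refine hs.eq_zero x fun l => ?_
    by_cases hl : l = k
    · rw [real_inner_comm, hwx, Finset.sum_eq_single k (fun l _ hl => hxl l hl) (by simp)] at hxw
      rw [hl]
      exact (mul_eq_zero.1 hxw).resolve_left hq.ne'
    · exact hxl l hl

/-- At `ε = 0` the point `w` is the barycenter of the dual facet and every `p k` is `v i₀`. The
finitely many strict inequalities needed already hold there, so they persist for small `ε > 0`. -/
theorem IsSelfPolarFamily.exists_truncate [FiniteDimensional ℝ E] [Finite ι] [Nontrivial κ]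
    {v : ι → E} (h : IsSelfPolarFamily v) {i₀ : ι} {a : κ → ι} (hs : IsSimpleVertex v i₀ a)
    (hcard : Fintype.card κ = Module.finrank ℝ E) :
    ∃ (u : ι ⊕ κ → E) (i₁ : ι ⊕ κ) (a' : κ → ι ⊕ κ),
      IsSelfPolarFamily u ∧ IsSimpleVertex u i₁ a' := by
  obtain ⟨e, hδ, hbasis, hdual⟩ := hs.exists_dual hcard
  set m : ℝ := ((Fintype.card κ : ℕ) : ℝ) with hm
  have hm0 : 0 < m := by rw [hm]; exact_mod_cast Fintype.card_pos
  let w : ℝ → E := fun ε => ((1 + ε) / m) • ∑ l, v (a l)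
  let p : ℝ → κ → E := fun ε k => v i₀ + (m * ε / (1 + ε)) • e k
  have hwc : ContinuousAt w 0 := by
    apply ContinuousAt.smul _ continuousAt_const
    exact (continuousAt_const.add continuousAt_id).div_const m
  have hpc : ∀ k, ContinuousAt (fun ε => p ε k) 0 := fun k => by
    apply continuousAt_const.add
    apply ContinuousAt.smul _ continuousAt_const
    exact (continuousAt_const.mul continuousAt_id).div (continuousAt_const.add continuousAt_id)
      (by simp)
  have hw0 : ∀ x, ⟪x, w 0⟫ = m⁻¹ * ∑ l, ⟪x, v (a l)⟫ := fun x => by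
    simp [w, inner_smul_right, inner_sum]
  have hp0 : ∀ k, p 0 k = v i₀ := fun k => by simp [p]
  have hnn : ∀ x : E, -1 < ⟪x, x⟫ := fun x => by
    have := real_inner_self_nonneg (x := x); linarith
  have hi₀ : i₀ ∉ Set.range a := fun hi => (hnn (v i₀)).ne' ((hs.inner_eq_iff i₀).2 hi)
  have hva : ∀ l, ⟪v i₀, v (a l)⟫ = -1 := fun l => (hs.inner_eq_iff _).2 ⟨l, rfl⟩
  have ha : Function.Injective a := fun k l hkl => by
    by_contra hne
    have h1 := hδ k l
    rw [← hkl, hδ, if_pos rfl, if_neg hne] at h1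
    exact one_ne_zero h1
  choose f hf using h.exposed
  have c1 : ∀ᶠ ε in nhds (0 : ℝ), ∀ i, i ≠ i₀ → -1 < ⟪w ε, v i⟫ := by
    rw [Filter.eventually_all]
    intro i
    by_cases hi : i = i₀
    · simp [hi]
    have h0 : -1 < ⟪w 0, v i⟫ := by
      rw [real_inner_comm, hw0]
      refine lt_average (fun l => h.neg_one_le_inner _ _) ?_
      by_contra! hno
      refine hi (h.injective (sub_eq_zero.1 (hs.eq_zero _ fun l => ?_)))
      rw [inner_sub_left, hva, le_antisymm (hno l) (h.neg_one_le_inner _ _), sub_self]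
    exact ((hwc.inner continuousAt_const).eventually (lt_mem_nhds h0)).mono fun _ h _ => h
  have c2 : ∀ᶠ ε in nhds (0 : ℝ), ∀ k i, i ∉ Set.range a → -1 < ⟪p ε k, v i⟫ := by
    simp only [Filter.eventually_all]
    intro k i hi
    have h0 : -1 < ⟪p 0 k, v i⟫ := by
      rw [hp0]
      exact lt_of_le_of_ne (h.neg_one_le_inner _ _) fun h' => hi ((hs.inner_eq_iff i).1 h'.symm)
    exact ((hpc k).inner continuousAt_const).eventually (lt_mem_nhds h0)
  have c3 : ∀ᶠ ε in nhds (0 : ℝ), ∀ k l, -1 < ⟪p ε k, p ε l⟫ := by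
    simp only [Filter.eventually_all]
    intro k l
    have h0 : -1 < ⟪p 0 k, p 0 l⟫ := by rw [hp0, hp0]; exact hnn _
    exact ((hpc k).inner (hpc l)).eventually (lt_mem_nhds h0)
  have c4 : ∀ᶠ ε in nhds (0 : ℝ), ∀ i, i ≠ i₀ → ⟪f i, v i⟫ < ⟪f i, w ε⟫ := by
    simp only [Filter.eventually_all]
    intro i _
    have h0 : ⟪f i, v i⟫ < ⟪f i, w 0⟫ := by
      rw [hw0]
      refine lt_average (fun l => ?_) ?_
      · by_cases hl : a l = i
        · rw [hl]
        · exact (hf i _ hl).le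
      -- The facet has at least two vertices, so its barycenter is not `v i`.
      · obtain ⟨k, l, hkl⟩ := exists_pair_ne κ
        by_cases hk : a k = i
        · exact ⟨l, hf i _ fun hl => hkl (ha (hk.trans hl.symm))⟩
        · exact ⟨k, hf i _ hk⟩
    exact (continuousAt_const.inner hwc).eventually (lt_mem_nhds h0)
  have c5 : ∀ᶠ ε in nhds (0 : ℝ), ∀ i, i ≠ i₀ → ∀ k, ⟪f i, v i⟫ < ⟪f i, p ε k⟫ := by
    simp only [Filter.eventually_all]
    intro i hi k
    have h0 : ⟪f i, v i⟫ < ⟪f i, p 0 k⟫ := by rw [hp0]; exact hf i _ (Ne.symm hi)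
    exact (continuousAt_const.inner (hpc k)).eventually (lt_mem_nhds h0)
  obtain ⟨ε, ⟨h1, h2, h3, h4, h5⟩, hε⟩ := (((c1.and (c2.and (c3.and (c4.and c5)))).filter_mono
    nhdsWithin_le_nhds).and (self_mem_nhdsWithin (a := (0 : ℝ)) (s := Set.Ioi 0))).exists
  have hε : 0 < ε := hε
  obtain ⟨k⟩ : Nonempty κ := inferInstance
  have key := h.truncate hs hδ hbasis hdual (ε := ε) (t := m * ε / (1 + ε)) (q := (1 + ε) / m)
    (w := w ε) (p := p ε) hε (by positivity) (by positivity)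
    (by rw [← hm]; field_simp) (by field_simp) rfl (fun _ => rfl) h1 h2 h3
    (fun i hi => ⟨f i, hf i, h4 i hi, h5 i hi⟩)
  exact ⟨_, _, _, key.1, key.2 k⟩

end Truncation

/-! ### Pyramids and the attainable vertex counts -/

section Realization

/-- There is a negatively self-polar family of `n` points in `ℝ^d` with a simple vertex. -/
def IsRealizable (d n : ℕ) : Prop :=
  ∃ (ι : Type) (_ : Fintype ι) (v : ι → EuclideanSpace ℝ (Fin d)) (i₀ : ι) (a : Fin d → ι),
    Fintype.card ι = n ∧ IsSelfPolarFamily v ∧ IsSimpleVertex v i₀ a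

theorem isRealizable_zero_one : IsRealizable 0 1 := by
  refine ⟨Unit, inferInstance, 0, (), Fin.elim0, rfl, ⟨by simp, fun x _ => ?_, ?_⟩, ?_, ?_⟩
  · exact subset_convexHull ℝ _ ⟨(), Subsingleton.elim _ _⟩
  · exact fun i => ⟨0, fun j hj => absurd (Subsingleton.elim _ _) hj⟩
  · intro j
    constructor
    · intro h
      norm_num at h
    · rintro ⟨k, -⟩
      exact k.elim0
  · exact fun x _ => Subsingleton.elim _ _

theorem IsRealizable.truncate {d n : ℕ} (h : IsRealizable d n) (hd : 2 ≤ d) :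
    IsRealizable d (n + d) := by
  classical
  obtain ⟨ι, _, v, i₀, a, rfl, hv, hs⟩ := h
  have : Nontrivial (Fin d) := Fin.nontrivial_iff_two_le.2 hd
  obtain ⟨u, i₁, a', hu, hs'⟩ := hv.exists_truncate hs (by simp)
  exact ⟨ι ⊕ Fin d, inferInstance, u, i₁, a', by simp, hu, hs'⟩

/-- The point of `ℝ^(d+1)` with first coordinate `r` and remaining coordinates `x`. -/
noncomputable def prependCoord {d : ℕ} (r : ℝ) (x : EuclideanSpace ℝ (Fin d)) :
    EuclideanSpace ℝ (Fin (d + 1)) :=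
  WithLp.toLp 2 (Fin.cons r x.ofLp)

theorem inner_prependCoord {d : ℕ} (r s : ℝ) (x y : EuclideanSpace ℝ (Fin d)) :
    ⟪prependCoord r x, prependCoord s y⟫ = r * s + ⟪x, y⟫ := by
  simp [prependCoord, PiLp.inner_apply, Fin.sum_univ_succ, mul_comm]

theorem exists_eq_prependCoord {d : ℕ} (z : EuclideanSpace ℝ (Fin (d + 1))) :
    ∃ r x, z = prependCoord r x :=
  ⟨z 0, WithLp.toLp 2 (Fin.tail z.ofLp), by
    ext i
    refine Fin.cases ?_ (fun i => ?_) i <;> simp [prependCoord]⟩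

theorem smul_prependCoord_add {d : ℕ} (c c' r s : ℝ) (x y : EuclideanSpace ℝ (Fin d)) :
    c • prependCoord r x + c' • prependCoord s y =
      prependCoord (c * r + c' * s) (c • x + c' • y) := by
  ext i
  refine Fin.cases ?_ (fun i => ?_) i <;> simp [prependCoord]

theorem prependCoord_mem_convexHull {d : ℕ} {s : Set (EuclideanSpace ℝ (Fin d))}
    {t : Set (EuclideanSpace ℝ (Fin (d + 1)))} {r c : ℝ}
    (h : ∀ y ∈ s, prependCoord r (c • y) ∈ convexHull ℝ t) {x : EuclideanSpace ℝ (Fin d)}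
    (hx : x ∈ convexHull ℝ s) : prependCoord r (c • x) ∈ convexHull ℝ t := by
  refine convexHull_min (t := {x | prependCoord r (c • x) ∈ convexHull ℝ t}) h ?_ hx
  intro x hx y hy α β hα hβ hαβ
  have h1 := convex_convexHull ℝ t hx hy hα hβ hαβ
  rw [smul_prependCoord_add, ← add_mul, hαβ, one_mul, smul_comm α c, smul_comm β c,
    ← smul_add] at h1
  exact h1

/-- The pyramid construction. -/
theorem IsRealizable.pyramid {d n : ℕ} (h : IsRealizable d n) : IsRealizable (d + 1) (n + 1) := by
  obtain ⟨ι, _, v, i₀, a, rfl, hv, hs⟩ := h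
  have h2 : √2 * √2 = 2 := Real.mul_self_sqrt (by norm_num)
  have h2pos : 0 < √2 := by positivity
  -- Heights `±1` make apex and base pair to `-1`; the factor `√2` turns base products into `1 + 2 *
  -- ⟪v i, v j⟫`, which fixes the value `-1`.
  let u : Option ι → EuclideanSpace ℝ (Fin (d + 1)) := fun o =>
    o.elim (prependCoord 1 0) fun i => prependCoord (-1) (√2 • v i)
  have hu₀ : u none = prependCoord 1 0 := rfl
  have hu : ∀ i, u (some i) = prependCoord (-1) (√2 • v i) := fun i => rfl
  have hss : ∀ i j, ⟪u (some i), u (some j)⟫ = 1 + 2 * ⟪v i, v j⟫ := fun i j => by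
    rw [hu, hu, inner_prependCoord, real_inner_smul_left, real_inner_smul_right, ← mul_assoc, h2]
    norm_num
  have hmem : ∀ o, u o ∈ convexHull ℝ (Set.range u) := fun o => subset_convexHull ℝ _ ⟨o, rfl⟩
  refine ⟨Option ι, inferInstance, u, some i₀, Fin.cons none fun k => some (a k), by simp,
    ⟨?_, ?_, ?_⟩, ?_, ?_⟩
  · rintro (_ | i) (_ | j)
    · rw [hu₀, inner_prependCoord]; norm_num
    · rw [hu₀, hu, inner_prependCoord]; norm_num
    · rw [hu₀, hu, inner_prependCoord]; norm_num
    · rw [hss]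
      have := hv.neg_one_le_inner i j
      linarith
  · intro z hz
    obtain ⟨r, x, rfl⟩ := exists_eq_prependCoord z
    have hr : -1 ≤ r := by
      have := hz none
      rw [hu₀, inner_prependCoord] at this
      simpa using this
    have hx : ∀ i, r - 1 ≤ √2 * ⟪x, v i⟫ := fun i => by
      have := hz (some i)
      rw [hu, inner_prependCoord, real_inner_smul_right] at this
      linarith
    have hbase : ∀ y, (∀ i, -1 ≤ ⟪y, v i⟫) → prependCoord (-1) (√2 • y) ∈
        convexHull ℝ (Set.range u) := fun y hy =>
      prependCoord_mem_convexHull (by rintro _ ⟨i, rfl⟩; exact hmem (some i))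
        (hv.mem_convexHull y hy)
    have hcase : 0 < 1 - r ∨ r = 1 ∧ x = 0 := by
      rcases lt_or_ge r 1 with h | h
      · exact Or.inl (by linarith)
      · obtain ⟨hr1, hx0⟩ := hv.eq_zero_of_le_inner (x := √2 • x) (sub_nonneg.2 h) fun i => by
          rw [real_inner_smul_left]
          exact hx i
        exact Or.inr ⟨by linarith, (smul_eq_zero.1 hx0).resolve_left h2pos.ne'⟩
    rcases hcase with hr1 | ⟨rfl, rfl⟩
    · have hy := hbase ((√2 / (1 - r)) • x) fun i => by
        rw [real_inner_smul_left, div_mul_eq_mul_div, le_div_iff₀ hr1]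
        have := hx i
        linarith
      have h1 := convex_convexHull ℝ (Set.range u) (hmem none) hy (a := (1 + r) / 2)
        (b := (1 - r) / 2) (by linarith) (by linarith) (by ring)
      rw [hu₀, smul_prependCoord_add] at h1
      convert h1 using 2
      · ring
      · rw [smul_zero, zero_add, smul_smul, smul_smul]
        have : (1 - r) / 2 * (√2 * (√2 / (1 - r))) = 1 := by
          field_simp
          linarith
        rw [mul_assoc, this, one_smul]
    · exact hmem none
  · rintro (_ | i)
    · refine ⟨prependCoord (-1) 0, ?_⟩
      rintro (_ | j) hj
      · exact absurd rfl hj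
      · rw [hu₀, hu, inner_prependCoord, inner_prependCoord]; norm_num
    · obtain ⟨f, hf⟩ := hv.exposed i
      -- The height coefficient is large enough that the apex cannot beat the base vertex.
      refine ⟨prependCoord (1 + √2 * |⟪f, v i⟫|) f, ?_⟩
      rintro (_ | j) hj
      · rw [hu₀, hu, inner_prependCoord, inner_prependCoord, real_inner_smul_right,
          inner_zero_right]
        have h1 := mul_le_mul_of_nonneg_left (le_abs_self ⟪f, v i⟫) h2pos.le
        have h3 := mul_nonneg h2pos.le (abs_nonneg ⟪f, v i⟫)
        linarith
      · rw [hu, hu, inner_prependCoord, inner_prependCoord, real_inner_smul_right,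
          real_inner_smul_right]
        have := mul_lt_mul_of_pos_left (hf j fun h => hj (by rw [h])) h2pos
        linarith
  · rintro (_ | j)
    · rw [hu, hu₀, inner_prependCoord]
      exact ⟨fun _ => ⟨0, rfl⟩, fun _ => by norm_num⟩
    · rw [hss]
      have h3 : 1 + 2 * ⟪v i₀, v j⟫ = -1 ↔ ⟪v i₀, v j⟫ = -1 := by
        constructor <;> intro h <;> linarith
      rw [h3, hs.inner_eq_iff, Fin.range_cons]
      simp
  · intro z hz
    obtain ⟨r, x, rfl⟩ := exists_eq_prependCoord z
    have hr : r = 0 := by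
      have := hz 0
      rw [Fin.cons_zero, hu₀, inner_prependCoord] at this
      simpa using this
    have hx : x = 0 := hs.eq_zero x fun k => by
      have := hz k.succ
      rw [Fin.cons_succ, hu, inner_prependCoord, real_inner_smul_right, hr] at this
      simpa [h2pos.ne'] using this
    rw [hr, hx]
    ext i
    refine Fin.cases ?_ (fun i => ?_) i <;> simp [prependCoord]

theorem isRealizable_three {n : ℕ} (hn : 4 ≤ n) (hn' : n ≠ 5) : IsRealizable 3 n := by
  have h23 : IsRealizable 2 3 := isRealizable_zero_one.pyramid.pyramid
  have h25 : IsRealizable 2 5 := h23.truncate le_rfl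
  have h27 : IsRealizable 2 7 := h25.truncate le_rfl
  induction n using Nat.strong_induction_on with
  | _ n ih =>
    by_cases h4 : n = 4
    · exact h4 ▸ h23.pyramid
    by_cases h6 : n = 6
    · exact h6 ▸ h25.pyramid
    -- A separate base case, since `8 - 3` is the excluded value 5.
    by_cases h8 : n = 8
    · exact h8 ▸ h27.pyramid
    obtain ⟨m, rfl⟩ : ∃ m, n = m + 3 := ⟨n - 3, by omega⟩
    exact (ih m (by omega) (by omega) (by omega)).truncate (by norm_num)

theorem isRealizable_of_ne {d : ℕ} (hd : 3 ≤ d) {n : ℕ} (hn : d + 1 ≤ n) (hn' : n ≠ d + 2) :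
    IsRealizable d n := by
  induction d, hd using Nat.le_induction generalizing n with
  | base => exact isRealizable_three hn hn'
  | succ d _ ih =>
    obtain ⟨m, rfl⟩ : ∃ m, n = m + 1 := ⟨n - 1, by omega⟩
    exact (ih (by omega) (by omega)).pyramid

theorem IsRealizable.exists_polytope {d n : ℕ} (h : IsRealizable d n) :
    ∃ P : Set (EuclideanSpace ℝ (Fin d)),
      IsPolytope P ∧ affDim P = d ∧ IsNegSelfPolar P ∧ (vert P).ncard = n := by
  obtain ⟨ι, _, v, i₀, a, rfl, hv, -⟩ := h
  refine ⟨convexHull ℝ (Set.range v), ⟨_, Set.finite_range v, rfl⟩, ?_, ?_, ?_⟩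
  · rw [affDim, hv.affineSpan_eq_top, AffineSubspace.direction_top, finrank_top,
      finrank_euclideanSpace_fin]
  · ext x
    simp only [polarSet, Set.mem_neg, Set.mem_ofPred_eq, inner_neg_left, neg_le]
    refine ⟨fun hx y hy => ?_, fun hx => hv.mem_convexHull x fun i =>
      hx _ (subset_convexHull ℝ _ ⟨i, rfl⟩)⟩
    refine le_inner_of_mem_convexHull ?_ hy
    rintro _ ⟨i, rfl⟩
    rw [real_inner_comm]
    refine le_inner_of_mem_convexHull ?_ hx
    rintro _ ⟨j, rfl⟩
    exact hv.neg_one_le_inner i j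
  · rw [vert, hv.extremePoints_eq, ← Nat.card_coe_set_eq, Nat.card_range_of_injective hv.injective,
      Nat.card_eq_fintype_card]

end Realization

theorem mainTheorem1 (d : ℕ) (hd : 3 ≤ d) (n : ℕ) (hn : d + 1 ≤ n) :
    (∃ P : Set (EuclideanSpace ℝ (Fin d)),
      IsPolytope P ∧ affDim P = d ∧ IsNegSelfPolar P ∧ (vert P).ncard = n) ↔ n ≠ d + 2 := by
  constructor
  · rintro ⟨P, hpol, -, hP, rfl⟩
    exact hP.ncard_vert_ne hpol
  · exact fun hn' => (isRealizable_of_ne hd hn hn').exists_polytope
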